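/- Let $V=\mathbb{C}^2$ with basis $e_1,e_2$, and let $V_n=\mathrm{Sym}^n(V)\subset V^{\otimes n}$ be the image of the symmetrizer $\frac1{n!}\sum_{\sigma}\sigma$. For $a,b\in\mathbb{N}$ let $\lceil a,b\rfloor=\{a+b-2j : 0\le j\le\min(a,b)\}$; call $\{a,b,c\}$ admissible if $c\in\lceil a,b\rfloor$, and put $\mathfrak{e}_a(b,c)=\frac{b+c-a}{2}$ and $\mathfrak{s}_a(b,c)=(-1)^{\mathfrak{e}_a(b,c)}$. The single-strand cup is $e_1\otimes e_2-e_2\otimes e_1\in V\otimes V$ and the single-strand cap is $v\otimes w\mapsto\det[v\;w]$; the cup and cap labeled $n$, $\cup_n\in V_n\otimes V_n$ and $\cap_n:V_n\otimes V_n\to\mathbb{C}$, consist of $n$ nested single-strand ones, symmetrized. For an admissible triple, the vertex $\iota^c_{a,b}:V_c\to V_a\otimes V_b$ (stem $c$ at the bottom, legs $a$ and $b$ at the upper left and upper right) includes $V_c$ in $V^{\otimes c}$, inserts $\mathfrak{e}_c(a,b)$ nested cups between the first $\mathfrak{e}_b(a,c)$ and the last $\mathfrak{e}_a(b,c)$ strands,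 and symmetrizes the first $a$ and the last $b$ strands; $\pi^c_{a,b}:V_a\otimes V_b\to V_c$ is its reflection in a horizontal line (with caps for cups). Put $$\Delta(c)=\cap_c(\cup_c),\qquad \Theta(a,b,c)=\cap_c\big((\pi^c_{a,b}\circ\iota^c_{a,b}\otimes\mathrm{id})(\cup_c)\big),\qquad \mathfrak{f}_c(a,b)=\frac{\Delta(c)}{\Theta(a,b,c)}.$$ The $6j$-symbols are the coefficients in $$(\mathrm{id}_{V_a}\otimes\iota^e_{b,c})\circ\iota^d_{a,e}=\sum_{f\in\lceil a,b\rfloor\cap\lceil c,d\rfloor}\begin{bmatrix}a&b&d\\c&e&f\end{bmatrix}(\iota^f_{a,b}\otimes\mathrm{id}_{V_c})\circ\iota^d_{f,c}.$$ Given an admissible triple $\{a,b,c\}$, $a'\in\lceil1,a\rfloor$ and $c'\in\lceil1,c\rfloor$, the fusion coefficient is $$\mathfrak{F}(b;a,a';c,c')=\mathfrak{s}_{a'}(1,a)\,\mathfrak{f}_{a'}(1,a)\begin{bmatrix}1&c&a'\\b&a&c'\end{bmatrix}.$$ **Proposition.** Let $\{a,b,c\}$ be an admissible triple. Then, as maps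 $V_b\to V_c\otimes V_1\otimes V_1\otimes V_a$, $$(\mathrm{id}_{V_c}\otimes\cup_1\otimes\mathrm{id}_{V_a})\circ\iota^b_{c,a}=\sum_{\substack{a'\in\lceil1,a\rfloor\\ c'\in\lceil1,c\rfloor\cap\lceil b,a'\rfloor}}\mathfrak{F}(b;a,a';c,c')\,(\iota^{c'}_{c,1}\otimes\iota^{a'}_{1,a})\circ\iota^b_{c',a'}.$$ That is, a vertex with lower leg $b$ and upper legs $c$ (left) and $a$ (right), with an arc labeled $1$ between the upper legs, both ends of the arc pointing up, is the sum of $\mathfrak{F}(b;a,a';c,c')$ times the diagram in which $b$ splits into $c'$ and $a'$, then $c'$ into $c,1$ and $a'$ into $1,a$. -/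

import Mathlib

open scoped TensorProduct

namespace SpinNetwork

noncomputable section

/-! ### Admissible triples and signs -/

/-- `iadm a b` is the set `⌈a,b⌋` of all `c = a + b - 2j` with `0 ≤ j ≤ min a b`;
`{a, b, c}` is an admissible triple when `c ∈ ⌈a,b⌋`. -/
def iadm (a b : ℕ) : Finset ℕ :=
  (Finset.range (min a b + 1)).image fun j => a + b - 2 * j

theorem mem_iadm {a b c : ℕ} :
    c ∈ iadm a b ↔ c ≤ a + b ∧ a ≤ b + c ∧ b ≤ a + c ∧ (a + b + c) % 2 = 0 := by
  simp only [iadm, Finset.mem_image, Finset.mem_range]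
  constructor
  · rintro ⟨j, hj, rfl⟩
    omega
  · rintro ⟨h1, h2, h3, h4⟩
    exact ⟨(a + b - c) / 2, by omega, by omega⟩

/-- `𝔢_a(b,c) = (b + c - a)/2`, the number of strands joining the edges `b` and `c` in an
admissible vertex `{a, b, c}` (the subtraction and the division are exact there). -/
def edges (a b c : ℕ) : ℕ := (b + c - a) / 2

/-- `𝔰_a(b,c) = (-1)^{𝔢_a(b,c)}`. -/
def sgn (a b c : ℕ) : ℂ := (-1) ^ edges a b c

/-! ### Tensor powers of `V = ℂ²` -/

/-- `V = ℂ²`. -/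
abbrev V : Type := Fin 2 → ℂ

/-- The standard basis of `ℂ²`. -/
def e (i : Fin 2) : V := Pi.single i 1

/-- The `n`-th tensor power of `V`. -/
abbrev T (n : ℕ) : Type := ⨂[ℂ]^n V

/-- The symmetrizer `(1/n!) ∑_σ σ` on `V^{⊗n}`. -/
def symmetrizer (n : ℕ) : T n →ₗ[ℂ] T n :=
  ((n.factorial : ℂ)⁻¹) •
    ∑ σ : Equiv.Perm (Fin n), (PiTensorProduct.reindex ℂ (fun _ : Fin n => V) σ).toLinearMap

/-- `V_n = Sym^n(V)`, the symmetric tensors in `V^{⊗n}`: the image of the symmetrizer. -/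
abbrev Sym (n : ℕ) : Submodule ℂ (T n) := LinearMap.range (symmetrizer n)

/-- The inclusion `V_n → V^{⊗n}`. -/
def incl (n : ℕ) : Sym n →ₗ[ℂ] T n := (Sym n).subtype

/-- The projection `V^{⊗n} → V_n` by symmetrizing. -/
def symz (n : ℕ) : T n →ₗ[ℂ] Sym n := (symmetrizer n).rangeRestrict

/-! ### Cups and caps -/

/-- The single-strand cap `v ⊗ w ↦ det [v w]`, as a bilinear form. -/
def detForm : V →ₗ[ℂ] V →ₗ[ℂ] ℂ :=
  LinearMap.mk₂ ℂ (fun v w => v 0 * w 1 - v 1 * w 0)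
    (fun _ _ _ => by simp only [Pi.add_apply]; ring)
    (fun _ _ _ => by simp only [Pi.smul_apply, smul_eq_mul]; ring)
    (fun _ _ _ => by simp only [Pi.add_apply]; ring)
    (fun _ _ _ => by simp only [Pi.smul_apply, smul_eq_mul]; ring)

theorem detForm_apply (v w : V) : detForm v w = (!![v 0, w 0; v 1, w 1]).det := by
  simp [detForm, Matrix.det_fin_two, mul_comm]

/-- `n` nested single-strand caps `V^{⊗n} ⊗ V^{⊗n} → ℂ`: the `i`-th strand from the left on the
left side is joined to the `i`-th strand from the right on the right side. -/
def nestedCap (n : ℕ) : T n ⊗[ℂ] T n →ₗ[ℂ] ℂ :=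
  TensorProduct.lift
    (((PiTensorProduct.map₂ fun _ : Fin n => detForm).compl₂
        (PiTensorProduct.reindex ℂ (fun _ : Fin n => V) Fin.revPerm).toLinearMap).compr₂
      (PiTensorProduct.constantBaseRingEquiv (Fin n) ℂ).toLinearMap)

theorem nestedCap_tprod (n : ℕ) (v w : Fin n → V) :
    nestedCap n (PiTensorProduct.tprod ℂ v ⊗ₜ[ℂ] PiTensorProduct.tprod ℂ w) =
      ∏ i, detForm (v i) (w i.rev) := by
  simp only [nestedCap, TensorProduct.lift.tmul, LinearMap.compr₂_apply, LinearMap.compl₂_apply,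
    LinearEquiv.coe_coe, AlgEquiv.toLinearMap_apply]
  erw [PiTensorProduct.reindex_tprod, PiTensorProduct.map₂_tprod_tprod]
  simp

/-- `n` nested single-strand cups in `V^{⊗n} ⊗ V^{⊗n}`. Each cup is `e₁ ⊗ e₂ - e₂ ⊗ e₁`; the sum
over `s` expands the `n` cups, the `i`-th one contributing `(-1)^{s i} e_{s i} ⊗ e_{1 - s i}` to the
`i`-th strand from the left on the left side and the `i`-th strand from the right on the right
side. -/
def nestedCup (n : ℕ) : T n ⊗[ℂ] T n :=
  ∑ s : Fin n → Fin 2, (∏ i, (-1 : ℂ) ^ (s i : ℕ)) •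
    (PiTensorProduct.tprod ℂ (fun i => e (s i)) ⊗ₜ[ℂ]
      PiTensorProduct.tprod ℂ (fun i : Fin n => e (1 - s i.rev)))

/-- The cup labeled `n`, an element of `V_n ⊗ V_n`. -/
def cup (n : ℕ) : Sym n ⊗[ℂ] Sym n := TensorProduct.map (symz n) (symz n) (nestedCup n)

/-- The cap labeled `n`, a linear form on `V_n ⊗ V_n`. -/
def cap (n : ℕ) : Sym n ⊗[ℂ] Sym n →ₗ[ℂ] ℂ :=
  nestedCap n ∘ₗ TensorProduct.map (incl n) (incl n)

/-! ### Trivalent vertices -/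

/-- `V^{⊗(β+α)} → V^{⊗(β+γ)} ⊗ V^{⊗(γ+α)}`, inserting `γ` nested cups between the first `β` and the
last `α` strands. -/
def strandsUp (α β γ : ℕ) : T (β + α) →ₗ[ℂ] T (β + γ) ⊗[ℂ] T (γ + α) :=
  TensorProduct.map TensorPower.mulEquiv.toLinearMap
      (TensorPower.mulEquiv.toLinearMap ∘ₗ (TensorProduct.comm ℂ (T α) (T γ)).toLinearMap)
    ∘ₗ (TensorProduct.tensorTensorTensorComm ℂ (T β) (T α) (T γ) (T γ)).toLinearMap
    ∘ₗ (TensorProduct.mk ℂ (T β ⊗[ℂ] T α) (T γ ⊗[ℂ] T γ)).flip (nestedCup γ)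
    ∘ₗ TensorPower.mulEquiv.symm.toLinearMap

/-- `V^{⊗(β+γ)} ⊗ V^{⊗(γ+α)} → V^{⊗(β+α)}`, closing the `2γ` middle strands by `γ` nested caps. -/
def strandsDown (α β γ : ℕ) : T (β + γ) ⊗[ℂ] T (γ + α) →ₗ[ℂ] T (β + α) :=
  TensorPower.mulEquiv.toLinearMap
    ∘ₗ (TensorProduct.rid ℂ (T β ⊗[ℂ] T α)).toLinearMap
    ∘ₗ TensorProduct.map LinearMap.id (nestedCap γ)
    ∘ₗ (TensorProduct.tensorTensorTensorComm ℂ (T β) (T γ) (T α) (T γ)).toLinearMap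
    ∘ₗ TensorProduct.map TensorPower.mulEquiv.symm.toLinearMap
      ((TensorProduct.comm ℂ (T γ) (T α)).toLinearMap ∘ₗ TensorPower.mulEquiv.symm.toLinearMap)

theorem edges_left {a b c : ℕ} (h : c ∈ iadm a b) : edges b a c + edges c a b = a := by
  rw [mem_iadm] at h; unfold edges; omega

theorem edges_right {a b c : ℕ} (h : c ∈ iadm a b) : edges c a b + edges a b c = b := by
  rw [mem_iadm] at h; unfold edges; omega

theorem edges_stem {a b c : ℕ} (h : c ∈ iadm a b) : edges b a c + edges a b c = c := by
  rw [mem_iadm] at h; unfold edges; omega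

/-- The vertex `V_c → V_a ⊗ V_b` with stem `c` at the bottom, upper left leg `a` and upper right leg
`b`: each pair of edges is joined by the appropriate number of strands and each edge is symmetrized.
(Used only for admissible triples; it is `0` otherwise.) -/
def vertex (a b c : ℕ) : Sym c →ₗ[ℂ] Sym a ⊗[ℂ] Sym b :=
  if h : c ∈ iadm a b then
    TensorProduct.map
        (symz a ∘ₗ (TensorPower.cast ℂ V (edges_left h)).toLinearMap)
        (symz b ∘ₗ (TensorPower.cast ℂ V (edges_right h)).toLinearMap)
      ∘ₗ strandsUp (edges a b c) (edges b a c) (edges c a b)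
      ∘ₗ (TensorPower.cast ℂ V (edges_stem h).symm).toLinearMap
      ∘ₗ incl c
  else 0

/-- The reflected vertex `V_a ⊗ V_b → V_c`, with lower left leg `a`, lower right leg `b` and `c` at
the top. (Used only for admissible triples; it is `0` otherwise.) -/
def vertexDown (a b c : ℕ) : Sym a ⊗[ℂ] Sym b →ₗ[ℂ] Sym c :=
  if h : c ∈ iadm a b then
    symz c
      ∘ₗ (TensorPower.cast ℂ V (edges_stem h)).toLinearMap
      ∘ₗ strandsDown (edges a b c) (edges b a c) (edges c a b)
      ∘ₗ TensorProduct.map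
        ((TensorPower.cast ℂ V (edges_left h).symm).toLinearMap ∘ₗ incl a)
        ((TensorPower.cast ℂ V (edges_right h).symm).toLinearMap ∘ₗ incl b)
  else 0

/-! ### Closed networks and the fusion constant -/

/-- `Δ(c)`: the value of a closed loop labeled `c`. -/
def loop (c : ℕ) : ℂ := cap c (cup c)

/-- `Θ(a,b,c)`: the value of the closed network with two vertices joined by edges `a` (left),
`b` (middle) and `c` (closing up on the right). -/
def theta (a b c : ℕ) : ℂ :=
  cap c (TensorProduct.map (vertexDown a b c ∘ₗ vertex a b c) LinearMap.id (cup c))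

/-- The fusion constant `𝔣_c(a,b) = Δ(c) / Θ(a,b,c)`. -/
def fusionConst (c a b : ℕ) : ℂ := loop c / theta a b c

/-! ### `6j`-symbols and the fusion coefficient -/

/-- The network `V_d → V_a ⊗ (V_b ⊗ V_c)`: `d` splits into `a` and `e`, then `e` into `b` and `c`. -/
def rightTree (a b c d e : ℕ) : Sym d →ₗ[ℂ] Sym a ⊗[ℂ] (Sym b ⊗[ℂ] Sym c) :=
  TensorProduct.map LinearMap.id (vertex b c e) ∘ₗ vertex a e d

/-- The network `V_d → (V_a ⊗ V_b) ⊗ V_c = V_a ⊗ (V_b ⊗ V_c)`: `d` splits into `f` and `c`, then `f`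
into `a` and `b`. -/
def leftTree (a b c d f : ℕ) : Sym d →ₗ[ℂ] Sym a ⊗[ℂ] (Sym b ⊗[ℂ] Sym c) :=
  (TensorProduct.assoc ℂ (Sym a) (Sym b) (Sym c)).toLinearMap
    ∘ₗ TensorProduct.map (vertex a b f) LinearMap.id ∘ₗ vertex f c d

/-- `S` is the family (indexed by `f`) of change-of-basis coefficients
`rightTree a b c d e = ∑_{f ∈ ⌈a,b⌋ ∩ ⌈c,d⌋} S f • leftTree a b c d f`. -/
def IsSixJ (a b d c e : ℕ) (S : ℕ → ℂ) : Prop :=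
  (∀ f, f ∉ iadm a b ∩ iadm c d → S f = 0) ∧
    rightTree a b c d e = ∑ f ∈ iadm a b ∩ iadm c d, S f • leftTree a b c d f

open Classical in
/-- The `6j`-symbol `[a b d; c e f]`: the coefficient of `leftTree a b c d f` in the expansion of
`rightTree a b c d e`. -/
def sixJ (a b d c e f : ℕ) : ℂ :=
  if h : ∃ S, IsSixJ a b d c e S then h.choose f else 0

/-- The fusion coefficient
`𝔉 = 𝔰_{a'}(1,a) · 𝔣_{a'}(1,a) · [1 c a'; b a c']`. -/
def fusionCoeff (b a a' c c' : ℕ) : ℂ :=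
  sgn a' 1 a * fusionConst a' 1 a * sixJ 1 c a' b a c'

/-! ### The two networks of the gluing relation, as maps
`V_b → V_c ⊗ (V_1 ⊗ (V_1 ⊗ V_a))` -/

/-- The vertex with stem `b` and upper legs `c` (left) and `a` (right), with an arc labeled `1`
between the two upper legs, both ends of the arc pointing up. -/
def gluedVertex (a b c : ℕ) :
    Sym b →ₗ[ℂ] Sym c ⊗[ℂ] (Sym 1 ⊗[ℂ] (Sym 1 ⊗[ℂ] Sym a)) :=
  TensorProduct.map LinearMap.id
      ((TensorProduct.assoc ℂ (Sym 1) (Sym 1) (Sym a)).toLinearMap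
        ∘ₗ TensorProduct.mk ℂ (Sym 1 ⊗[ℂ] Sym 1) (Sym a) (cup 1))
    ∘ₗ vertex c a b

/-- The vertex with stem `b` and upper legs `c'` (left) and `a'` (right), followed by `c'` splitting
into `c` and `1` and `a'` splitting into `1` and `a`. -/
def splitVertex (a b c a' c' : ℕ) :
    Sym b →ₗ[ℂ] Sym c ⊗[ℂ] (Sym 1 ⊗[ℂ] (Sym 1 ⊗[ℂ] Sym a)) :=
  (TensorProduct.assoc ℂ (Sym c) (Sym 1) (Sym 1 ⊗[ℂ] Sym a)).toLinearMap
    ∘ₗ TensorProduct.map (vertex c 1 c') (vertex 1 a a')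
    ∘ₗ vertex c' a' b

end

end SpinNetwork

open scoped TensorProduct
namespace SpinNetwork
noncomputable section

/-! ### Evaluation functionals -/

/-! Write [v,x] for the determinant. Evaluating tensors by v₁ ⊗ ⋯ ⊗ vₙ ↦ ∏ [vᵢ,x] turns V_n into
binary forms of degree n, and a vertex whose edges are joined by i, j, k strands becomes the
monomial [v,x]^i [v,y]^j [x,y]^k (`pair_vertex`). Pure powers span V_n and evaluations span its dual
(`span_pw`, `span_ev`), so equalities of networks are polynomial identities; in particular,
exchanging edges of a vertex costs only a sign.

Fix a'. After such exchanges the sum over c' is the left-tree side of a 6j-expansion with stem a',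
so it collapses to one right tree, in which a' splits into 1 and a, then a into c and b
(`bentSum_ev`). Everything is then expressed by one functional F on V_a: the original vertex, bent,
with c and b evaluated. The term a' = a - 1 is a multiple of F on the symmetrization of p ⊗ y ⊗ ⋯ ⊗
y, and a' = a + 1 gives the derivative of [y,p] F(y^a) in the direction q. With the fusion constants
a/(a+1) and 1, the Plücker relation (`polar_plucker`) combines these into [p,q] F(y^a), which is the
arc.

Since the 6j-symbols are chosen, with default 0, the expansions must be shown to exist; explicit
coefficients again come from Plücker. Uniqueness plays no role. -/

theorem detForm_eq (v w : V) : detForm v w = v 0 * w 1 - v 1 * w 0 := rfl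

theorem detForm_swap (v w : V) : detForm v w = -detForm w v := by
  simp only [detForm_eq]; ring

/-- The functional `v₁ ⊗ ⋯ ⊗ vₙ ↦ ∏ det[vᵢ, x]` on `V^{⊗n}`. -/
def evT (n : ℕ) (x : V) : T n →ₗ[ℂ] ℂ :=
  PiTensorProduct.lift ((MultilinearMap.mkPiAlgebra ℂ (Fin n) ℂ).compLinearMap
    fun _ => detForm.flip x)

@[simp] theorem evT_tprod (n : ℕ) (x : V) (v : Fin n → V) :
    evT n x (PiTensorProduct.tprod ℂ v) = ∏ i, detForm (v i) x := by
  simp [evT]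

theorem evT_reindex (n : ℕ) (x : V) (σ : Equiv.Perm (Fin n)) (t : T n) :
    evT n x (PiTensorProduct.reindex ℂ (fun _ : Fin n => V) σ t) = evT n x t := by
  have : evT n x ∘ₗ (PiTensorProduct.reindex ℂ (fun _ : Fin n => V) σ).toLinearMap = evT n x := by
    refine PiTensorProduct.ext (MultilinearMap.ext fun v => ?_)
    change evT n x (PiTensorProduct.reindex ℂ _ σ (PiTensorProduct.tprod ℂ v)) =
      evT n x (PiTensorProduct.tprod ℂ v)
    erw [PiTensorProduct.reindex_tprod]
    rw [evT_tprod, evT_tprod]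
    exact Equiv.prod_comp σ.symm fun i => detForm (v i) x
  exact LinearMap.congr_fun this t

/-- The average of a constant over the symmetric group. -/
theorem inv_factorial_smul_sum {M : Type*} [AddCommGroup M] [Module ℂ M] (n : ℕ) (m : M) :
    ((n.factorial : ℂ)⁻¹) • ∑ _σ : Equiv.Perm (Fin n), m = m := by
  rw [Finset.sum_const, Finset.card_univ, Fintype.card_perm, Fintype.card_fin,
    ← Nat.cast_smul_eq_nsmul ℂ, smul_smul, inv_mul_cancel₀, one_smul]
  exact_mod_cast n.factorial_ne_zero

theorem symmetrizer_apply (n : ℕ) (t : T n) :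
    symmetrizer n t = ((n.factorial : ℂ)⁻¹) •
      ∑ σ : Equiv.Perm (Fin n), PiTensorProduct.reindex ℂ (fun _ : Fin n => V) σ t := by
  simp [symmetrizer]

@[simp] theorem evT_symmetrizer (n : ℕ) (x : V) (t : T n) :
    evT n x (symmetrizer n t) = evT n x t := by
  rw [symmetrizer_apply, map_smul, map_sum]
  simp only [evT_reindex]
  exact inv_factorial_smul_sum n _

/-- The evaluation functional on `V_n`. -/
def ev (n : ℕ) (x : V) : Sym n →ₗ[ℂ] ℂ := evT n x ∘ₗ incl n

@[simp] theorem ev_symz (n : ℕ) (x : V) (t : T n) : ev n x (symz n t) = evT n x t := by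
  simp [ev, incl, symz]

/-- The pure power `v^{⊗n}` in `V_n`. -/
def pw (n : ℕ) (v : V) : Sym n := symz n (PiTensorProduct.tprod ℂ fun _ => v)

theorem incl_pw (n : ℕ) (v : V) : incl n (pw n v) = PiTensorProduct.tprod ℂ fun _ => v := by
  change symmetrizer n _ = _
  rw [symmetrizer_apply]
  refine Eq.trans ?_ (inv_factorial_smul_sum n _)
  congr 1
  refine Finset.sum_congr rfl fun σ _ => ?_
  erw [PiTensorProduct.reindex_tprod]

@[simp] theorem ev_pw (n : ℕ) (x v : V) : ev n x (pw n v) = detForm v x ^ n := by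
  simp [pw]

/-- The product of two functionals, on a tensor product. -/
def pair {M N : Type*} [AddCommMonoid M] [Module ℂ M] [AddCommMonoid N]
    [Module ℂ N] (f : M →ₗ[ℂ] ℂ) (g : N →ₗ[ℂ] ℂ) : M ⊗[ℂ] N →ₗ[ℂ] ℂ :=
  LinearMap.mul' ℂ ℂ ∘ₗ TensorProduct.map f g

section pair
variable {M N M' N' : Type*} [AddCommMonoid M] [Module ℂ M] [AddCommMonoid N] [Module ℂ N]
  [AddCommMonoid M'] [Module ℂ M'] [AddCommMonoid N'] [Module ℂ N']

@[simp] theorem pair_tmul (f : M →ₗ[ℂ] ℂ) (g : N →ₗ[ℂ] ℂ) (m : M) (n : N) :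
    pair f g (m ⊗ₜ[ℂ] n) = f m * g n := by
  simp [pair]

theorem pair_map (f : M →ₗ[ℂ] ℂ) (g : N →ₗ[ℂ] ℂ) (F : M' →ₗ[ℂ] M) (G : N' →ₗ[ℂ] N)
    (t : M' ⊗[ℂ] N') : pair f g (TensorProduct.map F G t) = pair (f ∘ₗ F) (g ∘ₗ G) t := by
  rw [pair, pair, TensorProduct.map_comp]; rfl

end pair

/-! ### Evaluation of strands -/

theorem mulEquiv_tprod {m n : ℕ} (v : Fin m → V) (w : Fin n → V) :
    TensorPower.mulEquiv (R := ℂ) (PiTensorProduct.tprod ℂ v ⊗ₜ[ℂ] PiTensorProduct.tprod ℂ w) =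
      PiTensorProduct.tprod ℂ (Fin.append v w) :=
  TensorPower.tprod_mul_tprod ℂ v w

theorem mulEquiv_pow {m n : ℕ} (v : V) :
    TensorPower.mulEquiv (R := ℂ) ((PiTensorProduct.tprod ℂ fun _ : Fin m => v) ⊗ₜ[ℂ]
      (PiTensorProduct.tprod ℂ fun _ : Fin n => v)) = PiTensorProduct.tprod ℂ fun _ => v := by
  rw [mulEquiv_tprod]
  congr 1
  ext1 i
  refine Fin.addCases (fun i => ?_) (fun i => ?_) i <;> simp

theorem mulEquiv_symm_pow {m n : ℕ} (v : V) :
    (TensorPower.mulEquiv (R := ℂ)).symm (PiTensorProduct.tprod ℂ fun _ : Fin (m + n) => v) =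
      (PiTensorProduct.tprod ℂ fun _ : Fin m => v) ⊗ₜ[ℂ]
      (PiTensorProduct.tprod ℂ fun _ : Fin n => v) := by
  rw [LinearEquiv.symm_apply_eq, mulEquiv_pow]

theorem cast_pow {m n : ℕ} (h : m = n) (v : V) :
    TensorPower.cast ℂ V h (PiTensorProduct.tprod ℂ fun _ => v) =
      PiTensorProduct.tprod ℂ fun _ => v := by
  rw [TensorPower.cast_tprod]; rfl

theorem evT_cast {m n : ℕ} (h : m = n) (x : V) :
    evT n x ∘ₗ (TensorPower.cast ℂ V h).toLinearMap = evT m x := by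
  subst h; rw [TensorPower.cast_refl]; rfl

theorem evT_mulEquiv (m n : ℕ) (x : V) :
    evT (m + n) x ∘ₗ TensorPower.mulEquiv.toLinearMap = pair (evT m x) (evT n x) := by
  refine TensorProduct.ext (PiTensorProduct.ext (MultilinearMap.ext fun v =>
    PiTensorProduct.ext (MultilinearMap.ext fun w => ?_)))
  change evT (m + n) x (TensorPower.mulEquiv (PiTensorProduct.tprod ℂ v ⊗ₜ[ℂ]
    PiTensorProduct.tprod ℂ w)) = pair (evT m x) (evT n x) (PiTensorProduct.tprod ℂ v ⊗ₜ[ℂ]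
    PiTensorProduct.tprod ℂ w)
  rw [mulEquiv_tprod, pair_tmul, evT_tprod, evT_tprod, evT_tprod, Fin.prod_univ_add]
  simp

/-- Distributivity turns the sum over words into a product over strands, each factor being a single
cup evaluated at x and y. -/
theorem pair_nestedCup (n : ℕ) (x y : V) :
    pair (evT n x) (evT n y) (nestedCup n) = detForm x y ^ n := by
  have h : ∀ s : Fin n → Fin 2, pair (evT n x) (evT n y) ((∏ i, (-1 : ℂ) ^ (s i : ℕ)) •
      (PiTensorProduct.tprod ℂ (fun i => e (s i)) ⊗ₜ[ℂ]
        PiTensorProduct.tprod ℂ (fun i : Fin n => e (1 - s i.rev)))) =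
      ∏ i, ((-1 : ℂ) ^ (s i : ℕ) * detForm (e (s i)) x * detForm (e (1 - s i)) y) := by
    intro s
    rw [map_smul, pair_tmul, evT_tprod, evT_tprod, smul_eq_mul,
      ← Equiv.prod_comp Fin.revPerm (fun i : Fin n => detForm (e (1 - s i.rev)) y)]
    simp only [Fin.revPerm_apply, Fin.rev_rev, Finset.prod_mul_distrib, mul_assoc]
  rw [nestedCup, map_sum, Finset.sum_congr rfl fun s _ => h s]
  rw [← Fintype.prod_sum (fun (_ : Fin n) (j : Fin 2) =>
    (-1 : ℂ) ^ (j : ℕ) * detForm (e j) x * detForm (e (1 - j)) y)]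
  simp [detForm_eq, e, Fin.sum_univ_two]
  ring

theorem pair_strandsUp (α β γ : ℕ) (x y v : V) :
    pair (evT (β + γ) x) (evT (γ + α) y)
        (strandsUp α β γ (PiTensorProduct.tprod ℂ fun _ => v)) =
      detForm v x ^ β * detForm v y ^ α * detForm x y ^ γ := by
  simp only [strandsUp, LinearMap.comp_apply, LinearEquiv.coe_coe, mulEquiv_symm_pow,
    LinearMap.flip_apply, TensorProduct.mk_apply]
  rw [pair_map, ← LinearMap.comp_assoc, evT_mulEquiv, evT_mulEquiv, ← pair_nestedCup γ x y]
  -- The claim is linear in the inserted tensor, so an arbitrary one may be reduced to pure tensors.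
  generalize nestedCup γ = u
  induction u with
  | zero => simp
  | add u w hu hw => simp only [TensorProduct.tmul_add, map_add, hu, hw]; ring
  | tmul u w => simp; ring

/-- The symmetrizers disappear: pure powers are already symmetric, and evaluations are invariant
under permuting strands. -/
theorem pair_vertex {a b c : ℕ} (h : c ∈ iadm a b) (x y v : V) :
    pair (ev a x) (ev b y) (vertex a b c (pw c v)) =
      detForm v x ^ edges b a c * detForm v y ^ edges a b c * detForm x y ^ edges c a b := by
  have hs : ∀ n x, ev n x ∘ₗ symz n = evT n x := fun n x => LinearMap.ext fun t => ev_symz n x t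
  rw [vertex, dif_pos h]
  simp only [LinearMap.comp_apply, LinearEquiv.coe_coe, incl_pw, cast_pow]
  rw [pair_map, ← LinearMap.comp_assoc, ← LinearMap.comp_assoc, hs, hs, evT_cast, evT_cast,
    pair_strandsUp]

theorem pair_cup (n : ℕ) (x y : V) : pair (ev n x) (ev n y) (cup n) = detForm x y ^ n := by
  have hs : ∀ n x, ev n x ∘ₗ symz n = evT n x := fun n x => LinearMap.ext fun t => ev_symz n x t
  rw [cup, pair_map, hs, hs, pair_nestedCup]

theorem evT_strandsDown (α β γ : ℕ) (x v w : V) :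
    evT (β + α) x (strandsDown α β γ ((PiTensorProduct.tprod ℂ fun _ => v) ⊗ₜ[ℂ]
      (PiTensorProduct.tprod ℂ fun _ => w))) =
      detForm v x ^ β * detForm w x ^ α * detForm v w ^ γ := by
  simp only [strandsDown, LinearMap.comp_apply, LinearEquiv.coe_coe, mulEquiv_symm_pow,
    TensorProduct.map_tmul, TensorProduct.comm_tmul, TensorProduct.tensorTensorTensorComm_tmul,
    nestedCap_tprod, TensorProduct.rid_tmul, map_smul, LinearMap.id_apply]
  have := LinearMap.congr_fun (evT_mulEquiv β α x) ((PiTensorProduct.tprod ℂ fun _ => v) ⊗ₜ[ℂ]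
      (PiTensorProduct.tprod ℂ fun _ => w))
  simp only [LinearMap.comp_apply, LinearEquiv.coe_coe] at this
  rw [this]
  simp
  ring

theorem ev_vertexDown {a b c : ℕ} (h : c ∈ iadm a b) (x v w : V) :
    ev c x (vertexDown a b c (pw a v ⊗ₜ[ℂ] pw b w)) =
      detForm v x ^ edges b a c * detForm w x ^ edges a b c * detForm v w ^ edges c a b := by
  rw [vertexDown, dif_pos h]
  simp only [LinearMap.comp_apply, LinearEquiv.coe_coe, TensorProduct.map_tmul, incl_pw, cast_pow,
    ev_symz]
  rw [← evT_strandsDown, ← evT_cast (edges_stem h)]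
  rfl

/-! ### Separation by evaluation functionals -/

theorem exists_perm_comp_eq {n : ℕ} (s r : Fin n → Fin 2)
    (h : (Finset.univ.filter fun i => s i = 0).card = (Finset.univ.filter fun i => r i = 0).card) :
    ∃ σ : Equiv.Perm (Fin n), r ∘ σ = s := by
  have hc : Fintype.card {i // s i = 0} = Fintype.card {i // r i = 0} := by
    rw [Fintype.card_subtype, Fintype.card_subtype, h]
  refine ⟨(Fintype.equivOfCardEq hc).extendSubtype, funext fun i => ?_⟩
  by_cases hi : s i = 0
  · rw [hi]
    exact (Fintype.equivOfCardEq hc).extendSubtype_mem i hi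
  · have := (Fintype.equivOfCardEq hc).extendSubtype_not_mem i hi
    simp only [Function.comp_apply]
    omega

/-- A symmetric function on words in two letters is determined by its generating function. -/
theorem eq_zero_of_symmetric {n : ℕ} (u : (Fin n → Fin 2) → ℂ)
    (hu : ∀ s (σ : Equiv.Perm (Fin n)), u (s ∘ σ) = u s)
    (h : ∀ t : ℂ, ∑ s, u s * ∏ i, (if s i = 0 then t else 1) = 0) (s : Fin n → Fin 2) :
    u s = 0 := by
  let N : (Fin n → Fin 2) → ℕ := fun r => (Finset.univ.filter fun i => r i = 0).card
  let P : Polynomial ℂ := ∑ r, Polynomial.monomial (N r) (u r)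
  have hP : P = 0 := by
    refine Polynomial.funext fun t => ?_
    rw [Polynomial.eval_zero, ← h t, Polynomial.eval_finsetSum]
    refine Finset.sum_congr rfl fun r _ => ?_
    rw [Polynomial.eval_monomial, Finset.prod_ite]
    simp [N]
  -- Words with equally many zeros are permutations of each other, so this coefficient is a nonzero
  -- multiple of `u s`.
  have hc : P.coeff (N s) = (Finset.univ.filter fun r => N r = N s).card * u s := by
    simp only [P, Polynomial.finsetSum_coeff, Polynomial.coeff_monomial]
    rw [← Finset.sum_filter, ← nsmul_eq_mul]
    refine Finset.sum_eq_card_nsmul fun r hr => ?_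
    obtain ⟨σ, hσ⟩ := exists_perm_comp_eq r s (Finset.mem_filter.1 hr).2
    rw [← hσ, hu]
  rw [hP, Polynomial.coeff_zero] at hc
  refine (mul_eq_zero.1 hc.symm).resolve_left ?_
  refine Nat.cast_ne_zero.2 ?_
  exact Finset.card_ne_zero_of_mem (Finset.mem_filter.2 ⟨Finset.mem_univ s, rfl⟩)

/-- The standard basis of `V^{⊗n}`. -/
def basisT (n : ℕ) : Module.Basis (Fin n → Fin 2) ℂ (T n) :=
  Basis.piTensorProduct fun _ => Pi.basisFun ℂ (Fin 2)

theorem basisT_apply (n : ℕ) (s : Fin n → Fin 2) :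
    basisT n s = PiTensorProduct.tprod ℂ fun i => e (s i) := by
  rw [basisT, Basis.piTensorProduct_apply]
  simp [e]

instance (n : ℕ) : FiniteDimensional ℂ (T n) := Module.Finite.of_basis (basisT n)

instance (n : ℕ) : FiniteDimensional ℂ (Sym n) := 
  FiniteDimensional.finiteDimensional_submodule (Sym n)

instance (n : ℕ) : Module.Free ℂ (Sym n) := Module.Free.of_divisionRing ℂ (Sym n)

instance (n : ℕ) : Module.IsReflexive ℂ (Sym n) := inferInstance

theorem reindex_basisT (n : ℕ) (σ : Equiv.Perm (Fin n)) (s : Fin n → Fin 2) :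
    PiTensorProduct.reindex ℂ (fun _ : Fin n => V) σ (basisT n s) = basisT n (s ∘ σ.symm) := by
  rw [basisT_apply, basisT_apply]
  erw [PiTensorProduct.reindex_tprod]
  rfl

theorem reindex_symmetrizer (n : ℕ) (σ : Equiv.Perm (Fin n)) (t : T n) :
    PiTensorProduct.reindex ℂ (fun _ : Fin n => V) σ (symmetrizer n t) = symmetrizer n t := by
  rw [symmetrizer_apply, map_smul, map_sum]
  congr 1
  refine Fintype.sum_equiv (Equiv.mulLeft σ) _ _ fun τ => ?_
  erw [PiTensorProduct.reindex_reindex]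
  rfl

theorem symmetrizer_reindex (n : ℕ) (σ : Equiv.Perm (Fin n)) (t : T n) :
    symmetrizer n (PiTensorProduct.reindex ℂ (fun _ : Fin n => V) σ t) = symmetrizer n t := by
  rw [symmetrizer_apply, symmetrizer_apply]
  congr 1
  refine Fintype.sum_equiv (Equiv.mulRight σ) _ _ fun τ => ?_
  erw [PiTensorProduct.reindex_reindex]
  rfl

theorem symmetrizer_incl (n : ℕ) (u : Sym n) : symmetrizer n (incl n u) = incl n u := by
  obtain ⟨_, t, rfl⟩ := u
  change symmetrizer n (symmetrizer n t) = symmetrizer n t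
  rw [symmetrizer_apply n (symmetrizer n t)]
  simp only [reindex_symmetrizer]
  exact inv_factorial_smul_sum n _

theorem reindex_incl (n : ℕ) (σ : Equiv.Perm (Fin n)) (u : Sym n) :
    PiTensorProduct.reindex ℂ (fun _ : Fin n => V) σ (incl n u) = incl n u := by
  rw [← symmetrizer_incl, reindex_symmetrizer]

theorem symz_incl (n : ℕ) (u : Sym n) : symz n (incl n u) = u :=
  Subtype.ext (symmetrizer_incl n u)

theorem eq_zero_of_ev_eq_zero {n : ℕ} {u : Sym n} (h : ∀ x, ev n x u = 0) : u = 0 := by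
  have hr : ∀ s, (basisT n).repr (incl n u) s = 0 := by
    refine eq_zero_of_symmetric _ (fun s σ => ?_) fun t => ?_
    · have key : ∀ t : T n, (basisT n).repr (PiTensorProduct.reindex ℂ (fun _ : Fin n => V) σ t) s =
          (basisT n).repr t (s ∘ σ) := by
        intro t
        have : (basisT n).coord s ∘ₗ (PiTensorProduct.reindex ℂ (fun _ : Fin n => V) σ).toLinearMap
            = (basisT n).coord (s ∘ σ) := by
          refine (basisT n).ext fun r => ?_
          rw [LinearMap.comp_apply]
          erw [reindex_basisT]
          simp only [Module.Basis.coord_apply, Module.Basis.repr_self, Finsupp.single_apply]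
          congr 1
          rw [eq_iff_iff]
          constructor
          · rintro rfl; ext i; simp
          · rintro rfl; ext i; simp
        exact LinearMap.congr_fun this t
      rw [← key, reindex_incl]
    -- At x = (-1, t) one has [e₁,x] = t and [e₂,x] = 1, so the evaluation is the generating
    -- function of the coordinates.
    · have := h ![-1, t]
      rw [ev, LinearMap.comp_apply, ← (basisT n).sum_repr (incl n u), map_sum] at this
      rw [← this]
      refine Finset.sum_congr rfl fun s _ => ?_
      rw [map_smul, smul_eq_mul, basisT_apply, evT_tprod]
      congr 1
      refine Finset.prod_congr rfl fun i _ => ?_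
      generalize s i = j
      fin_cases j <;> simp [detForm_eq, e]
  have : incl n u = 0 := (basisT n).ext_elem fun s => by simpa using hr s
  exact Subtype.ext this

theorem eq_of_ev_eq {n : ℕ} {u w : Sym n} (h : ∀ x, ev n x u = ev n x w) : u = w :=
  sub_eq_zero.1 (eq_zero_of_ev_eq_zero fun x => by rw [map_sub, h, sub_self])

theorem eq_zero_of_apply_pw_eq_zero {n : ℕ} {f : Sym n →ₗ[ℂ] ℂ} (h : ∀ v, f (pw n v) = 0) :
    f = 0 := by
  have hb : ∀ s, f (symz n (basisT n s)) = 0 := by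
    refine eq_zero_of_symmetric _ (fun s σ => ?_) fun t => ?_
    · congr 1
      have := reindex_basisT n σ (s ∘ σ)
      rw [Function.comp_assoc, Equiv.self_comp_symm, Function.comp_id] at this
      refine Subtype.ext ?_
      change symmetrizer n _ = symmetrizer n _
      rw [← this, symmetrizer_reindex]
    · rw [← h ![t, 1], pw, ← (basisT n).sum_repr (PiTensorProduct.tprod ℂ fun _ => ![t, 1]),
        map_sum, map_sum]
      refine Finset.sum_congr rfl fun s _ => ?_
      rw [map_smul, map_smul, basisT, Basis.piTensorProduct_repr_tprod_apply, smul_eq_mul, mul_comm]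
      congr 1
      refine Finset.prod_congr rfl fun i _ => ?_
      generalize s i = j
      fin_cases j <;> simp
  refine LinearMap.ext fun u => ?_
  rw [← symz_incl n u, ← (basisT n).sum_repr (incl n u), map_sum, map_sum]
  refine Finset.sum_eq_zero fun s _ => ?_
  rw [map_smul, map_smul, hb, smul_zero]

theorem dual_ext {n : ℕ} {f g : Sym n →ₗ[ℂ] ℂ} (h : ∀ v, f (pw n v) = g (pw n v)) : f = g :=
  sub_eq_zero.1 (eq_zero_of_apply_pw_eq_zero fun v => by rw [LinearMap.sub_apply, h, sub_self])

theorem span_pw (n : ℕ) : Submodule.span ℂ (Set.range (pw n)) = ⊤ := by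
  by_contra hne
  obtain ⟨f, hf, hle⟩ := Submodule.exists_le_ker_of_lt_top
    (Submodule.span ℂ (Set.range (pw n))) (Ne.lt_top hne)
  exact hf (eq_zero_of_apply_pw_eq_zero fun v => hle (Submodule.subset_span ⟨v, rfl⟩))

theorem hom_ext {n : ℕ} {M : Type*} [AddCommMonoid M] [Module ℂ M] {f g : Sym n →ₗ[ℂ] M}
    (h : ∀ v, f (pw n v) = g (pw n v)) : f = g :=
  LinearMap.ext_on_range (span_pw n) h

/-- By finite dimension a subspace of the dual is recovered from its common kernel, which is zero
here. -/
theorem span_ev (n : ℕ) : Submodule.span ℂ (Set.range (ev n)) = ⊤ := by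
  have : (Submodule.span ℂ (Set.range (ev n))).dualCoannihilator = ⊥ := by
    rw [eq_bot_iff]
    intro u hu
    refine eq_zero_of_ev_eq_zero fun x => ?_
    exact (Submodule.mem_dualCoannihilator u).1 hu _ (Submodule.subset_span ⟨x, rfl⟩)
  refine (Subspace.dualCoannihilator_dualAnnihilator_eq (K := ℂ) (V := Sym n)).symm.trans ?_
  rw [this, Submodule.dualAnnihilator_bot]

/-- Every functional on `V_n` is a combination of evaluations. -/
theorem dual_induction {n : ℕ} {P : (Sym n →ₗ[ℂ] ℂ) → Prop} (hev : ∀ x, P (ev n x)) (h0 : P 0)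
    (hadd : ∀ f g, P f → P g → P (f + g)) (hsmul : ∀ (r : ℂ) f, P f → P (r • f))
    (f : Sym n →ₗ[ℂ] ℂ) : P f := by
  have hf : f ∈ Submodule.span ℂ (Set.range (ev n)) := by rw [span_ev]; trivial
  induction hf using Submodule.span_induction with
  | mem f hf => obtain ⟨x, rfl⟩ := hf; exact hev x
  | zero => exact h0
  | add f g _ _ hf hg => exact hadd f g hf hg
  | smul r f _ hf => exact hsmul r f hf

/-- A family of functionals separates points. -/
def Separating {ι M : Type*} [AddCommMonoid M] [Module ℂ M] (F : ι → M →ₗ[ℂ] ℂ) : Prop :=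
  ∀ m m', (∀ i, F i m = F i m') → m = m'

theorem separating_ev (n : ℕ) : Separating (ev n) := fun _ _ h => eq_of_ev_eq h

/-- Contracting the second factor with G leaves vectors of M, separated by F. Conversely, along a
basis of M a tensor has coordinates in N, which are separated by G. -/
theorem Separating.pair {ι κ M N : Type*} [AddCommMonoid M] [Module ℂ M] [Module.Free ℂ M]
    [AddCommMonoid N] [Module ℂ N] {F : ι → M →ₗ[ℂ] ℂ} {G : κ → N →ₗ[ℂ] ℂ} (hF : Separating F) (hG : Separating G) :
    Separating fun p : ι × κ => SpinNetwork.pair (F p.1) (G p.2) := by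
  intro m m' h
  have h1 : ∀ j, (TensorProduct.rid ℂ M) (TensorProduct.map LinearMap.id (G j) m) =
      (TensorProduct.rid ℂ M) (TensorProduct.map LinearMap.id (G j) m') := by
    intro j
    refine hF _ _ fun i => ?_
    have key : ∀ w : M ⊗[ℂ] N, F i ((TensorProduct.rid ℂ M)
        (TensorProduct.map LinearMap.id (G j) w)) = SpinNetwork.pair (F i) (G j) w := by
      intro w
      induction w with
      | zero => simp
      | add u w hu hw => simp only [map_add, hu, hw]
      | tmul u w => simp [mul_comm]
    rw [key, key, h (i, j)]
  classical
  let b := Module.Free.chooseBasis ℂ M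
  refine (TensorProduct.equivFinsuppOfBasisLeft (N := N) b).injective (Finsupp.ext fun k => ?_)
  refine hG _ _ fun j => ?_
  have key : ∀ w : M ⊗[ℂ] N, G j (TensorProduct.equivFinsuppOfBasisLeft b w k) =
      b.coord k ((TensorProduct.rid ℂ M) (TensorProduct.map LinearMap.id (G j) w)) := by
    intro w
    induction w with
    | zero => simp
    | add u w hu hw => simp only [map_add, Finsupp.add_apply, hu, hw]
    | tmul u w => simp [mul_comm]
  rw [key, key, h1]

theorem separating_pair_ev (a b : ℕ) :
    Separating fun p : V × V => SpinNetwork.pair (ev a p.1) (ev b p.2) :=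
  Separating.pair (M := Sym a) (N := Sym b) (separating_ev a) (separating_ev b)

theorem tmul_ext {a b : ℕ} {w w' : Sym a ⊗[ℂ] Sym b}
    (h : ∀ x y, pair (ev a x) (ev b y) w = pair (ev a x) (ev b y) w') : w = w' :=
  separating_pair_ev a b _ _ fun p => h p.1 p.2

/-! ### The loop value -/

theorem detForm_e_mul (j k : Fin 2) :
    (-1 : ℂ) ^ (k : ℕ) * detForm (e j) (e (1 - k)) = if j = k then 1 else 0 := by
  fin_cases j <;> fin_cases k <;> simp [detForm_eq, e]

/-- The signs of the cups cancel those of the caps strand by strand, so only terms 0 and 1 remain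
and the loop value cannot cancel to zero. -/
theorem nestedCap_symmetrizer (n : ℕ) (s : Fin n → Fin 2) :
    (∏ i, (-1 : ℂ) ^ (s i : ℕ)) * nestedCap n
      (symmetrizer n (PiTensorProduct.tprod ℂ fun i => e (s i)) ⊗ₜ[ℂ]
        symmetrizer n (PiTensorProduct.tprod ℂ fun i : Fin n => e (1 - s i.rev))) =
      ((n.factorial : ℂ)⁻¹) ^ 2 * ∑ σ : Equiv.Perm (Fin n), ∑ τ : Equiv.Perm (Fin n),
        ∏ i, if s (σ.symm i) = s (τ.symm i.rev).rev then 1 else 0 := by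
  rw [symmetrizer_apply, symmetrizer_apply, TensorProduct.smul_tmul_smul, map_smul, smul_eq_mul,
    TensorProduct.sum_tmul, map_sum, mul_left_comm, sq]
  congr 1
  rw [Finset.mul_sum]
  refine Finset.sum_congr rfl fun σ _ => ?_
  rw [TensorProduct.tmul_sum, map_sum, Finset.mul_sum]
  refine Finset.sum_congr rfl fun τ _ => ?_
  erw [PiTensorProduct.reindex_tprod, PiTensorProduct.reindex_tprod]
  rw [nestedCap_tprod,
    ← Equiv.prod_comp ((Fin.revPerm.trans τ.symm).trans Fin.revPerm) fun i => (-1 : ℂ) ^ (s i : ℕ),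
    ← Finset.prod_mul_distrib]
  exact Finset.prod_congr rfl fun i _ => detForm_e_mul _ _

theorem loop_ne_zero (n : ℕ) : loop n ≠ 0 := by
  have hs : incl n ∘ₗ symz n = symmetrizer n := rfl
  have h : loop n = ((n.factorial : ℂ)⁻¹) ^ 2 *
      ((∑ s : Fin n → Fin 2, ∑ σ : Equiv.Perm (Fin n), ∑ τ : Equiv.Perm (Fin n),
        ∏ i, if s (σ.symm i) = s (τ.symm i.rev).rev then 1 else 0 : ℕ) : ℂ) := by
    rw [loop, cap, cup, LinearMap.comp_apply, ← LinearMap.comp_apply (TensorProduct.map _ _),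
      ← TensorProduct.map_comp, hs, nestedCup, map_sum, map_sum]
    push_cast
    rw [Finset.mul_sum]
    refine Finset.sum_congr rfl fun s _ => ?_
    rw [map_smul, map_smul, smul_eq_mul, TensorProduct.map_tmul, nestedCap_symmetrizer]
  rw [h]
  refine mul_ne_zero (pow_ne_zero _ (inv_ne_zero (Nat.cast_ne_zero.2 n.factorial_ne_zero)))
    (Nat.cast_ne_zero.2 (ne_of_gt ?_))
  -- The constant word with two identity permutations contributes 1.
  refine Finset.sum_pos' (fun _ _ => Nat.zero_le _) ⟨0, Finset.mem_univ _, ?_⟩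
  refine Finset.sum_pos' (fun _ _ => Nat.zero_le _) ⟨1, Finset.mem_univ _, ?_⟩
  refine Finset.sum_pos' (fun _ _ => Nat.zero_le _) ⟨1, Finset.mem_univ _, ?_⟩
  simp

/-! ### Polynomial identities for the vertices -/

section pair
variable {M N : Type*} [AddCommMonoid M] [Module ℂ M] [AddCommMonoid N] [Module ℂ N]

/-- `pair f g w` as a linear function of `f`. -/
def pairLeft (g : N →ₗ[ℂ] ℂ) (w : M ⊗[ℂ] N) : (M →ₗ[ℂ] ℂ) →ₗ[ℂ] ℂ where
  toFun f := pair f g w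
  map_add' f f' := by simp [pair, TensorProduct.map_add_left]
  map_smul' r f := by simp [pair, TensorProduct.map_smul_left]

/-- `pair f g w` as a linear function of `g`. -/
def pairRight (f : M →ₗ[ℂ] ℂ) (w : M ⊗[ℂ] N) : (N →ₗ[ℂ] ℂ) →ₗ[ℂ] ℂ where
  toFun g := pair f g w
  map_add' g g' := by simp [pair, TensorProduct.map_add_right]
  map_smul' r g := by simp [pair, TensorProduct.map_smul_right]

theorem pair_smul_left (r : ℂ) (f : M →ₗ[ℂ] ℂ) (g : N →ₗ[ℂ] ℂ) (w : M ⊗[ℂ] N) :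
    pair (r • f) g w = r * pair f g w :=
  map_smul (pairLeft g w) r f

theorem pair_smul_right (r : ℂ) (f : M →ₗ[ℂ] ℂ) (g : N →ₗ[ℂ] ℂ) (w : M ⊗[ℂ] N) :
    pair f (r • g) w = r * pair f g w :=
  map_smul (pairRight f w) r g

end pair

/-- A linear function on the dual of `V_n` is determined by its values on evaluations. -/
theorem dualMap_ext {n : ℕ} {M : Type*} [AddCommGroup M] [Module ℂ M]
    {A B : (Sym n →ₗ[ℂ] ℂ) →ₗ[ℂ] M} (h : ∀ x, A (ev n x) = B (ev n x)) : A = B :=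
  LinearMap.ext_on_range (span_ev n) h

theorem mem_iadm_of_eq {a b c i j k : ℕ} (ha : a = i + k) (hb : b = k + j) (hc : c = i + j) :
    c ∈ iadm a b := by
  rw [mem_iadm]; omega

theorem exists_eq_add_of_mem_iadm {a b c : ℕ} (h : c ∈ iadm a b) :
    ∃ i j k, a = i + k ∧ b = k + j ∧ c = i + j :=
  ⟨edges b a c, edges a b c, edges c a b, (edges_left h).symm, (edges_right h).symm,
    (edges_stem h).symm⟩

theorem pair_vertex_of_eq {a b c i j k : ℕ} (ha : a = i + k) (hb : b = k + j) (hc : c = i + j)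
    (x y v : V) : pair (ev a x) (ev b y) (vertex a b c (pw c v)) =
      detForm v x ^ i * detForm v y ^ j * detForm x y ^ k := by
  have h1 : edges b a c = i := by unfold edges; omega
  have h2 : edges a b c = j := by unfold edges; omega
  have h3 : edges c a b = k := by unfold edges; omega
  rw [pair_vertex (mem_iadm_of_eq ha hb hc), h1, h2, h3]

theorem ev_vertexDown_of_eq {a b c i j k : ℕ} (ha : a = i + k) (hb : b = k + j) (hc : c = i + j)
    (x v w : V) : ev c x (vertexDown a b c (pw a v ⊗ₜ[ℂ] pw b w)) =
      detForm v x ^ i * detForm w x ^ j * detForm v w ^ k := by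
  have h1 : edges b a c = i := by unfold edges; omega
  have h2 : edges a b c = j := by unfold edges; omega
  have h3 : edges c a b = k := by unfold edges; omega
  rw [ev_vertexDown (mem_iadm_of_eq ha hb hc), h1, h2, h3]

/-- Exchanging the upper legs of a vertex. -/
theorem pair_vertex_swap {a b c : ℕ} (h : c ∈ iadm a b) (x y : V) :
    pair (ev a x) (ev b y) ∘ₗ vertex a b c =
      sgn c b a • (pair (ev b y) (ev a x) ∘ₗ vertex b a c) := by
  refine dual_ext fun v => ?_
  obtain ⟨i, j, k, ha, hb, hc⟩ := exists_eq_add_of_mem_iadm h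
  have h3 : edges c b a = k := by unfold edges; omega
  simp only [LinearMap.comp_apply, LinearMap.smul_apply, smul_eq_mul]
  rw [pair_vertex_of_eq ha hb hc, pair_vertex_of_eq (i := j) (j := i) (k := k) (by omega) (by omega)
    (by omega), sgn, h3, detForm_swap x y, neg_pow]
  ring

/-- Exchanging the stem and the right leg of a vertex. -/
theorem pair_vertex_rotate {a b c : ℕ} (h : b ∈ iadm c a) (f : Sym c →ₗ[ℂ] ℂ) (y v : V) :
    pair f (ev a y) (vertex c a b (pw b v)) =
      (-1) ^ ((a + b + c) / 2) * pair f (ev b v) (vertex c b a (pw a y)) := by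
  obtain ⟨i, j, k, hc, ha, hb⟩ := exists_eq_add_of_mem_iadm h
  -- Both sides are linear in `f`, so evaluations suffice. There the two monomials agree up to
  -- reversing all i + j + k determinants.
  have : pairLeft (ev a y) (vertex c a b (pw b v)) =
      ((-1 : ℂ) ^ ((a + b + c) / 2)) • pairLeft (ev b v) (vertex c b a (pw a y)) := by
    refine dualMap_ext fun x => ?_
    change pair (ev c x) (ev a y) _ = _ * pair (ev c x) (ev b v) _
    have hs : (a + b + c) / 2 = i + j + k := by omega
    rw [pair_vertex_of_eq hc ha hb, pair_vertex_of_eq (i := k) (j := j) (k := i) (by omega)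
      (by omega) (by omega), hs, detForm_swap v x, detForm_swap v y, detForm_swap x y, neg_pow,
      neg_pow (detForm y v), neg_pow (detForm y x)]
    ring
  exact LinearMap.congr_fun this f

theorem vertex_add_pw (a b : ℕ) (v : V) : vertex a b (a + b) (pw (a + b) v) = pw a v ⊗ₜ pw b v := by
  refine tmul_ext fun x y => ?_
  rw [pair_vertex_of_eq (i := a) (j := b) (k := 0) (by omega) (by omega) (by omega)]
  simp

/-! ### Polarization -/

/-- The symmetrization of `p ⊗ v ⊗ ⋯ ⊗ v`. -/
def polar (n : ℕ) (p v : V) : Sym (n + 1) :=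
  symz (n + 1) (PiTensorProduct.tprod ℂ (Fin.cons p fun _ => v))

theorem ev_polar (n : ℕ) (x p v : V) :
    ev (n + 1) x (polar n p v) = detForm p x * detForm v x ^ n := by
  rw [polar, ev_symz, evT_tprod, Fin.prod_univ_succ]
  simp

theorem hasDerivAt_detForm_left (v p x : V) :
    HasDerivAt (fun t : ℂ => detForm (v + t • p) x) (detForm p x) 0 := by
  simp only [map_add, map_smul, LinearMap.add_apply, LinearMap.smul_apply, smul_eq_mul]
  simpa using ((hasDerivAt_id (0 : ℂ)).mul_const (detForm p x)).const_add (detForm v x)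

theorem hasDerivAt_detForm_right (v p x : V) :
    HasDerivAt (fun t : ℂ => detForm v (x + t • p)) (detForm v p) 0 := by
  simp only [map_add, map_smul, smul_eq_mul]
  simpa using ((hasDerivAt_id (0 : ℂ)).mul_const (detForm v p)).const_add (detForm v x)

/-- For evaluations this is the power rule, and both sides are linear in `f`. Values on polarized
tensors can thus be found by differentiating values on pure powers. -/
theorem hasDerivAt_apply_pw {n : ℕ} (p v : V) (f : Sym (n + 1) →ₗ[ℂ] ℂ) :
    HasDerivAt (fun t : ℂ => f (pw (n + 1) (v + t • p))) ((n + 1) * f (polar n p v)) 0 := by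
  refine dual_induction (P := fun f => HasDerivAt (fun t : ℂ => f (pw (n + 1) (v + t • p)))
    ((n + 1) * f (polar n p v)) 0) (fun x => ?_) ?_ (fun f g hf hg => ?_) (fun r f hf => ?_) f
  · simp only [ev_pw, ev_polar]
    refine ((hasDerivAt_detForm_left v p x).pow (n + 1)).congr_deriv ?_
    simp; ring
  · simpa using hasDerivAt_const (0 : ℂ) (0 : ℂ)
  · refine (hf.add hg).congr_deriv ?_
    simp; ring
  · refine (hf.const_mul r).congr_deriv ?_
    simp; ring

theorem hasDerivAt_apply_ev {n : ℕ} (q y : V) (A : (Sym (n + 1) →ₗ[ℂ] ℂ) →ₗ[ℂ] ℂ) :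
    HasDerivAt (fun t : ℂ => A (ev (n + 1) (y + t • q)))
      ((n + 1) * A (pair (ev 1 q) (ev n y) ∘ₗ vertex 1 n (n + 1))) 0 := by
  -- By reflexivity `A` is evaluation at a vector, which by linearity may be taken to be a pure
  -- power.
  obtain ⟨u, rfl⟩ := (Module.evalEquiv ℂ (Sym (n + 1))).surjective A
  change HasDerivAt (fun t : ℂ => ev (n + 1) (y + t • q) u)
    ((n + 1) * pair (ev 1 q) (ev n y) (vertex 1 n (n + 1) u)) 0
  have hu : u ∈ Submodule.span ℂ (Set.range (pw (n + 1))) := by rw [span_pw]; trivial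
  induction hu using Submodule.span_induction with
  | mem f hf =>
    obtain ⟨v, rfl⟩ := hf
    rw [pair_vertex_of_eq (i := 1) (j := n) (k := 0) (by omega) (by omega) (by omega)]
    simp only [ev_pw]
    refine ((hasDerivAt_detForm_right v q y).pow (n + 1)).congr_deriv ?_
    simp; ring
  | zero => simpa using hasDerivAt_const (0 : ℂ) (0 : ℂ)
  | add f g _ _ hf hg =>
    simp only [map_add]
    refine (hf.add hg).congr_deriv ?_
    ring
  | smul r f _ hf =>
    simp only [map_smul, smul_eq_mul]
    refine (hf.const_mul r).congr_deriv ?_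
    ring

/-- The edge 1 is one end of a single cup; evaluating it at p inserts p into the other end. -/
theorem pair_ev_vertex_one_lower (n : ℕ) (p v : V) (f : Sym (n + 1) →ₗ[ℂ] ℂ) :
    pair (ev 1 p) f (vertex 1 (n + 1) n (pw n v)) = f (polar n p v) := by
  have : pairRight (ev 1 p) (vertex 1 (n + 1) n (pw n v)) = .applyₗ (polar n p v) := by
    refine dualMap_ext fun y => ?_
    change pair (ev 1 p) (ev (n + 1) y) _ = ev (n + 1) y _
    rw [pair_vertex_of_eq (i := 0) (j := n) (k := 1) (by omega) (by omega) (by omega), ev_polar]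
    ring
  exact LinearMap.congr_fun this f

theorem pair_ev_vertex_one_upper (n : ℕ) (p v : V) (f : Sym n →ₗ[ℂ] ℂ) :
    pair (ev 1 p) f (vertex 1 n (n + 1) (pw (n + 1) v)) = detForm v p * f (pw n v) := by
  have := vertex_add_pw 1 n v
  rw [add_comm 1 n] at this
  rw [this]; simp

theorem pair_ev_comp_vertex_one_lower (n : ℕ) (q y : V) :
    pair (ev 1 q) (ev (n + 1) y) ∘ₗ vertex 1 (n + 1) n = detForm q y • ev n y := by
  refine dual_ext fun v => ?_
  rw [LinearMap.comp_apply, pair_ev_vertex_one_lower, ev_polar]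
  simp

/-! ### Fusion constants -/

/-- If the bubble is the scalar r, then Θ = rΔ, and Δ ≠ 0 cancels. -/
theorem fusionConst_of_comp_eq_smul {a b c : ℕ} {r : ℂ}
    (h : vertexDown a b c ∘ₗ vertex a b c = r • LinearMap.id) : fusionConst c a b = r⁻¹ := by
  rw [fusionConst, theta, h, TensorProduct.map_smul_left, TensorProduct.map_id]
  change loop c / cap c (r • cup c) = _
  rw [map_smul, smul_eq_mul]
  change loop c / (r * loop c) = _
  rw [div_mul_cancel_right₀ (loop_ne_zero c)]

theorem fusionConst_upper (n : ℕ) : fusionConst (n + 1) 1 n = 1 := by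
  rw [fusionConst_of_comp_eq_smul (r := 1), inv_one]
  refine hom_ext fun v => eq_of_ev_eq fun x => ?_
  have := vertex_add_pw 1 n v
  rw [add_comm 1 n] at this
  rw [LinearMap.comp_apply, this,
    ev_vertexDown_of_eq (i := 1) (j := n) (k := 0) (by omega) (by omega) (by omega)]
  simp; ring

theorem vertex_one_lower_pw (n : ℕ) (v : V) : vertex 1 (n + 1) n (pw n v) =
    pw 1 (e 0) ⊗ₜ[ℂ] polar n (e 1) v + (-1 : ℂ) • (pw 1 (e 1) ⊗ₜ[ℂ] polar n (e 0) v) := by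
  refine tmul_ext fun x y => ?_
  rw [pair_ev_vertex_one_lower, map_add, map_smul, pair_tmul, pair_tmul]
  simp only [ev_pw, ev_polar, detForm_eq]
  simp [e]; ring

/-- Obtained by differentiating the monomial for p ⊗ v^(n+1) at v in the direction q. For n = 0 the
truncated exponent is harmless, its term having the factor n. -/
theorem ev_vertexDown_polar (n : ℕ) (x p q v : V) :
    (n + 1) * ev n x (vertexDown 1 (n + 1) n (pw 1 p ⊗ₜ[ℂ] polar n q v)) =
      n * detForm v x ^ (n - 1) * detForm q x * detForm p v + detForm v x ^ n * detForm p q := by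
  have h := hasDerivAt_apply_pw q v
    (ev n x ∘ₗ vertexDown 1 (n + 1) n ∘ₗ TensorProduct.mk ℂ (Sym 1) (Sym (n + 1)) (pw 1 p))
  refine h.unique ?_
  simp only [LinearMap.comp_apply, TensorProduct.mk_apply]
  simp only [ev_vertexDown_of_eq (a := 1) (b := n + 1) (c := n) (i := 0) (j := n) (k := 1)
    (by omega) (by omega) (by omega)]
  refine (((hasDerivAt_detForm_left v q x).pow n).const_mul (detForm p x ^ 0)).mul
    ((hasDerivAt_detForm_right p q v).pow 1) |>.congr_deriv ?_
  simp

theorem fusionConst_lower (n : ℕ) : fusionConst n 1 (n + 1) = (n + 1) / (n + 2) := by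
  have hn : (n + 1 : ℂ) ≠ 0 := by exact_mod_cast n.succ_ne_zero
  rw [fusionConst_of_comp_eq_smul (r := (n + 2) / (n + 1)), inv_div]
  refine hom_ext fun v => eq_of_ev_eq fun x => ?_
  rw [LinearMap.comp_apply, vertex_one_lower_pw, map_add, map_add, map_smul,
    map_smul, LinearMap.smul_apply, map_smul,
    LinearMap.id_apply, ev_pw, smul_eq_mul]
  refine mul_left_cancel₀ hn ?_
  rw [smul_eq_mul, mul_add, mul_left_comm, ev_vertexDown_polar, ev_vertexDown_polar]
  field_simp
  -- This identity accounts for n copies of [v,x]^n and the two values below for two more, whence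
  -- the factor n + 2.
  have h1 : detForm (e 1) x * detForm (e 0) v - detForm (e 0) x * detForm (e 1) v
      = detForm v x := by
    simp [detForm_eq, e]; ring
  have h2 : detForm (e 0) (e 1) = 1 := by simp [detForm_eq, e]
  have h3 : detForm (e 1) (e 0) = -1 := by simp [detForm_eq, e]
  rw [h2, h3]
  rcases n with _ | n
  · norm_num
  · simp only [Nat.add_sub_cancel]
    linear_combination (n + 1 : ℕ) * detForm v x ^ n * h1

/-! ### Existence of the `6j`-symbols with an edge labeled `1` -/

theorem pair_assoc {M N P : Type*} [AddCommMonoid M] [Module ℂ M] [AddCommMonoid N] [Module ℂ N]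
    [AddCommMonoid P] [Module ℂ P] (f : M →ₗ[ℂ] ℂ) (g : N →ₗ[ℂ] ℂ) (h : P →ₗ[ℂ] ℂ)
    (w : (M ⊗[ℂ] N) ⊗[ℂ] P) :
    pair f (pair g h) (TensorProduct.assoc ℂ M N P w) = pair (pair f g) h w := by
  have : pair f (pair g h) ∘ₗ (TensorProduct.assoc ℂ M N P).toLinearMap = pair (pair f g) h :=
    TensorProduct.ext_threefold fun x y z => by simp [mul_assoc]
  exact LinearMap.congr_fun this w

theorem tree_ext {a b c d : ℕ} {F G : Sym d →ₗ[ℂ] Sym a ⊗[ℂ] (Sym b ⊗[ℂ] Sym c)}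
    (h : ∀ v x y z, pair (ev a x) (pair (ev b y) (ev c z)) (F (pw d v)) =
      pair (ev a x) (pair (ev b y) (ev c z)) (G (pw d v))) : F = G :=
  hom_ext fun v => Separating.pair (M := Sym a) (N := Sym b ⊗[ℂ] Sym c) (separating_ev a)
    (separating_pair_ev b c) _ _ fun p => h v p.1 p.2.1 p.2.2

theorem pair_leftTree (a b c d f : ℕ) (x y z : V) (u : Sym d) :
    pair (ev a x) (pair (ev b y) (ev c z)) (leftTree a b c d f u) =
      pair (pair (ev a x) (ev b y) ∘ₗ vertex a b f) (ev c z) (vertex f c d u) := by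
  rw [leftTree]
  simp only [LinearMap.comp_apply, LinearEquiv.coe_coe]
  rw [pair_assoc, pair_map, LinearMap.comp_id]

theorem pair_rightTree (a b c d e : ℕ) (x y z : V) (u : Sym d) :
    pair (ev a x) (pair (ev b y) (ev c z)) (rightTree a b c d e u) =
      pair (ev a x) (pair (ev b y) (ev c z) ∘ₗ vertex b c e) (vertex a e d u) := by
  rw [rightTree]
  simp only [LinearMap.comp_apply]
  rw [pair_map, LinearMap.comp_id]

theorem leftTree_eq_zero {a b c d f : ℕ} (h : f ∉ iadm c d) : leftTree a b c d f = 0 := by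
  have : d ∉ iadm f c := fun hd => h (by rw [mem_iadm] at hd ⊢; omega)
  rw [leftTree, vertex, vertex, dif_neg this]
  simp

theorem hasDerivAt_leftTree_upper (b c d : ℕ) (p x z v : V) :
    HasDerivAt (fun t : ℂ => pair (ev (c + 1) (x + t • p)) (ev b z) (vertex (c + 1) b d (pw d v)))
      ((c + 1) * pair (ev 1 p) (pair (ev c x) (ev b z)) (leftTree 1 c b d (c + 1) (pw d v))) 0 := by
  rw [pair_leftTree]
  exact hasDerivAt_apply_ev p x (pairLeft (ev b z) (vertex (c + 1) b d (pw d v)))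

theorem pair_leftTree_lower (b c d : ℕ) (p x z v : V) :
    pair (ev 1 p) (pair (ev (c + 1) x) (ev b z)) (leftTree 1 (c + 1) b d c (pw d v)) =
      detForm p x * pair (ev c x) (ev b z) (vertex c b d (pw d v)) := by
  rw [pair_leftTree, pair_ev_comp_vertex_one_lower, pair_smul_left]

/-- The inner vertex polarizes the leg c + 1, so the value is the derivative of the outer monomial
in x along p. -/
theorem pair_leftTree_upper_of_eq {b c d i j k : ℕ} (hc : c + 1 = i + k) (hb : b = k + j)
    (hd : d = i + j) (p x z v : V) :
    (c + 1) * pair (ev 1 p) (pair (ev c x) (ev b z)) (leftTree 1 c b d (c + 1) (pw d v)) =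
      i * detForm v x ^ (i - 1) * detForm v p * detForm v z ^ j * detForm x z ^ k +
        detForm v x ^ i * detForm v z ^ j * (k * detForm x z ^ (k - 1) * detForm p z) := by
  refine (hasDerivAt_leftTree_upper b c d p x z v).unique ?_
  simp only [pair_vertex_of_eq hc hb hd]
  refine ((((hasDerivAt_detForm_right v p x).pow i).mul_const (detForm v z ^ j)).mul
    ((hasDerivAt_detForm_left x p z).pow k)).congr_deriv ?_
  simp

theorem pair_leftTree_upper_succ_of_eq {b m d i j k : ℕ} (hc : m + 2 = i + k) (hb : b = k + j)
    (hd : d = i + j) (p x z v : V) :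
    (m + 2) * pair (ev 1 p) (pair (ev (m + 1) x) (ev b z))
        (leftTree 1 (m + 1) b d (m + 2) (pw d v)) =
      i * detForm v x ^ (i - 1) * detForm v p * detForm v z ^ j * detForm x z ^ k +
        detForm v x ^ i * detForm v z ^ j * (k * detForm x z ^ (k - 1) * detForm p z) := by
  have := pair_leftTree_upper_of_eq (c := m + 1) hc hb hd p x z v
  rwa [show ((m + 1 : ℕ) : ℂ) + 1 = m + 2 by push_cast; ring] at this

theorem pair_leftTree_lower_of_eq {b c d i j k : ℕ} (hc : c = i + k) (hb : b = k + j)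
    (hd : d = i + j) (p x z v : V) :
    pair (ev 1 p) (pair (ev (c + 1) x) (ev b z)) (leftTree 1 (c + 1) b d c (pw d v)) =
      detForm p x * (detForm v x ^ i * detForm v z ^ j * detForm x z ^ k) := by
  rw [pair_leftTree_lower, pair_vertex_of_eq hc hb hd]

theorem pair_rightTree_upper_of_eq {a b c i j k : ℕ} (hc : c = i + k) (hb : b = k + j)
    (ha : a = i + j) (p x z v : V) :
    pair (ev 1 p) (pair (ev c x) (ev b z)) (rightTree 1 c b (a + 1) a (pw (a + 1) v)) =
      detForm v p * (detForm v x ^ i * detForm v z ^ j * detForm x z ^ k) := by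
  rw [pair_rightTree, pair_ev_vertex_one_upper, LinearMap.comp_apply, pair_vertex_of_eq hc hb ha]

theorem pair_rightTree_lower_of_eq {b c n i j k : ℕ} (hc : c = i + k) (hb : b = k + j)
    (ha : n + 1 = i + j) (p x z v : V) :
    (n + 1) * pair (ev 1 p) (pair (ev c x) (ev b z)) (rightTree 1 c b n (n + 1) (pw n v)) =
      i * detForm v x ^ (i - 1) * detForm p x * detForm v z ^ j * detForm x z ^ k +
        detForm v x ^ i * (j * detForm v z ^ (j - 1) * detForm p z) * detForm x z ^ k := by
  rw [pair_rightTree, pair_ev_vertex_one_lower]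
  refine (hasDerivAt_apply_pw p v (pair (ev c x) (ev b z) ∘ₗ vertex c b (n + 1))).unique ?_
  simp only [LinearMap.comp_apply, pair_vertex_of_eq hc hb ha]
  refine ((((hasDerivAt_detForm_left v p x).pow i).mul
    ((hasDerivAt_detForm_left v p z).pow j)).mul_const (detForm x z ^ k)).congr_deriv ?_
  simp only [zero_smul, add_zero, Pi.pow_apply]
  ring

theorem detForm_plucker (v p x z : V) :
    detForm v p * detForm x z - detForm v x * detForm p z + detForm v z * detForm p x = 0 := by
  simp only [detForm_eq]; ring

theorem iadm_one_zero : iadm 1 0 = {1} := by decide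

theorem iadm_one_succ (n : ℕ) : iadm 1 (n + 1) = {n + 2, n} := by
  ext m; simp only [mem_iadm, Finset.mem_insert, Finset.mem_singleton]; omega

/-- Indices outside `iadm c d` may be included freely, since their trees vanish by the default value
of `vertex`. -/
theorem exists_isSixJ_of_eq_sum {a b c d e : ℕ} (s : ℕ → ℂ)
    (h : rightTree a b c d e = ∑ f ∈ iadm a b, s f • leftTree a b c d f) :
    ∃ S, IsSixJ a b d c e S := by
  refine ⟨fun f => if f ∈ iadm a b ∩ iadm c d then s f else 0, fun f hf => if_neg hf, ?_⟩
  rw [h]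
  symm
  refine (Finset.sum_subset Finset.inter_subset_left fun f _ hf => ?_).trans
    (Finset.sum_congr rfl fun f hf => ?_)
  · simp only [if_neg hf, zero_smul]
  · by_cases hf' : f ∈ iadm c d
    · simp only [if_pos (Finset.mem_inter.2 ⟨hf, hf'⟩)]
    · rw [leftTree_eq_zero hf', smul_zero, smul_zero]

/-- With M = [v,x]^i [v,z]^j [x,z]^k the right tree is [v,p] M. The left tree f = c + 1, times c +
1, is (i+1)[v,p] M plus k times a term containing [v,x][p,z]. Plücker rewrites this as [v,p][x,z] +
[v,z][p,x], giving (i+1+k)[v,p] M = (c+1)[v,p] M plus k times the tree f = c - 1. -/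
theorem exists_isSixJ_upper {a b c : ℕ} (h : a ∈ iadm c b) : ∃ S, IsSixJ 1 c (a + 1) b a S := by
  obtain ⟨i, j, k, hc, hb, ha⟩ := exists_eq_add_of_mem_iadm h
  rcases c with _ | m
  · refine exists_isSixJ_of_eq_sum (fun _ => 1) (tree_ext fun v p x z => ?_)
    have hL := pair_leftTree_upper_of_eq (c := 0) (b := b) (d := a + 1) (i := 1) (j := j) (k := 0)
      (by omega) (by omega) (by omega) p x z v
    obtain ⟨rfl, rfl⟩ : i = 0 ∧ k = 0 := by omega
    rw [pair_rightTree_upper_of_eq hc hb ha, iadm_one_zero, Finset.sum_singleton, one_smul]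
    simp at hL
    simp [hL]
  · refine exists_isSixJ_of_eq_sum (fun f => if f = m + 2 then 1 else -k / (m + 2))
      (tree_ext fun v p x z => ?_)
    have hL := pair_leftTree_upper_succ_of_eq (m := m) (b := b) (d := a + 1) (i := i + 1) (j := j)
      (k := k) (by omega) (by omega) (by omega) p x z v
    rw [pair_rightTree_upper_of_eq hc hb ha, iadm_one_succ, Finset.sum_pair (by omega), if_pos rfl,
      if_neg (by omega), one_smul, LinearMap.add_apply, map_add, LinearMap.smul_apply, map_smul,
      smul_eq_mul]
    have hm : (m + 2 : ℂ) ≠ 0 := by exact_mod_cast (m + 1).succ_ne_zero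
    have hm' : (m + 1 : ℂ) = i + k := by exact_mod_cast hc
    refine mul_left_cancel₀ hm ?_
    rw [mul_add, hL]
    -- For k = 0 the tree f = c - 1 is not admissible, but its coefficient is zero.
    rcases k with _ | k
    · simp only [Nat.cast_zero, neg_zero, zero_div, zero_mul, Nat.add_sub_cancel]
      push_cast at hm' ⊢
      linear_combination detForm v p * detForm v x ^ i * detForm v z ^ j * hm'
    · rw [pair_leftTree_lower_of_eq (i := i) (j := j + 1) (k := k) (by omega) (by omega) (by omega)]
      simp only [Nat.add_sub_cancel]
      push_cast at hm' ⊢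
      field_simp
      linear_combination detForm v p * detForm v x ^ i * detForm v z ^ j * detForm x z ^ (k + 1) *
        hm' + (k + 1) * detForm v x ^ i * detForm v z ^ j * detForm x z ^ k *
          detForm_plucker v p x z

/-- Times n + 1, the right tree is i times the left tree f = c - 1 plus j times a monomial
containing [p,z]. By Plücker that monomial is the left tree f = c + 1 plus i/(c+1) times the tree f
= c - 1. -/
theorem exists_isSixJ_lower {n b c : ℕ} (h : n + 1 ∈ iadm c b) :
    ∃ S, IsSixJ 1 c n b (n + 1) S := by
  obtain ⟨i, j, k, hc, hb, ha⟩ := exists_eq_add_of_mem_iadm h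
  have hn : (n + 1 : ℂ) ≠ 0 := by exact_mod_cast n.succ_ne_zero
  have hn' : (n + 1 : ℂ) = i + j := by exact_mod_cast ha
  rcases c with _ | m
  · refine exists_isSixJ_of_eq_sum (fun _ => 1) (tree_ext fun v p x z => ?_)
    have hL := pair_leftTree_upper_of_eq (c := 0) (b := b) (d := n) (i := 0) (j := n) (k := 1)
      (by omega) (by omega) (by omega) p x z v
    have hR := pair_rightTree_lower_of_eq hc hb ha p x z v
    obtain ⟨rfl, rfl⟩ : i = 0 ∧ k = 0 := by omega
    obtain rfl : j = n + 1 := by omega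
    refine mul_left_cancel₀ hn ?_
    rw [hR, iadm_one_zero, Finset.sum_singleton, one_smul]
    simp at hL
    simp [hL]
    ring
  · refine exists_isSixJ_of_eq_sum
      (fun f => if f = m + 2 then j / (n + 1) else (i + i * j / (m + 2)) / (n + 1))
      (tree_ext fun v p x z => ?_)
    have hR := pair_rightTree_lower_of_eq hc hb ha p x z v
    rw [iadm_one_succ, Finset.sum_pair (by omega), if_pos rfl,
      if_neg (by omega), LinearMap.add_apply, map_add, LinearMap.smul_apply, map_smul,
      LinearMap.smul_apply, map_smul, smul_eq_mul, smul_eq_mul]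
    have hm : (m + 2 : ℂ) ≠ 0 := by exact_mod_cast (m + 1).succ_ne_zero
    have hm' : (m + 1 : ℂ) = i + k := by exact_mod_cast hc
    refine mul_left_cancel₀ hn (mul_left_cancel₀ hm ?_)
    rw [hR]
    rcases i with _ | i
    · rcases j with _ | j
      · omega
      · have hL := pair_leftTree_upper_succ_of_eq (m := m) (b := b) (d := n) (i := 0) (j := j)
          (k := k + 1) (by omega) (by omega) (by omega) p x z v
        simp only [Nat.add_sub_cancel] at hL ⊢
        push_cast at hL hm' ⊢
        field_simp
        linear_combination (-(j : ℂ) - 1) * hL + (j + 1) * detForm v z ^ j * detForm x z ^ k *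
          detForm p z * hm'
    · rw [pair_leftTree_lower_of_eq (i := i) (j := j) (k := k) (by omega) (by omega) (by omega)]
      rcases j with _ | j
      · push_cast
        field_simp
        ring
      · have hL := pair_leftTree_upper_succ_of_eq (m := m) (b := b) (d := n) (i := i + 1) (j := j)
          (k := k + 1) (by omega) (by omega) (by omega) p x z v
        simp only [Nat.add_sub_cancel] at hL ⊢
        push_cast at hL hm' ⊢
        field_simp
        linear_combination (-(j : ℂ) - 1) * hL + (j + 1) * detForm v z ^ j * detForm x z ^ k *
          detForm v x ^ (i + 1) * detForm p z * hm'
          - (i + 1) * (j + 1) * detForm v x ^ i * detForm v z ^ j * detForm x z ^ k *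
            detForm_plucker v p x z

theorem isSixJ_sixJ {a b c d e : ℕ} (h : ∃ S, IsSixJ a b d c e S) :
    IsSixJ a b d c e (sixJ a b d c e) := by
  have : sixJ a b d c e = h.choose := by
    funext f; rw [sixJ, dif_pos h]
  rw [this]
  exact h.choose_spec

/-! ### The gluing relation -/

theorem quad_ext {a b : ℕ} {c d n : ℕ}
    {F G : Sym n →ₗ[ℂ] Sym a ⊗[ℂ] (Sym b ⊗[ℂ] (Sym c ⊗[ℂ] Sym d))}
    (h : ∀ v x p q y, pair (ev a x) (pair (ev b p) (pair (ev c q) (ev d y))) (F (pw n v)) =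
      pair (ev a x) (pair (ev b p) (pair (ev c q) (ev d y))) (G (pw n v))) : F = G :=
  hom_ext fun v => Separating.pair (M := Sym a) (N := Sym b ⊗[ℂ] (Sym c ⊗[ℂ] Sym d))
    (separating_ev a) (Separating.pair (M := Sym b) (N := Sym c ⊗[ℂ] Sym d) (separating_ev b)
      (separating_pair_ev c d)) _ _ fun r => h v r.1 r.2.1 r.2.2.1 r.2.2.2

theorem pair_gluedVertex (a b c : ℕ) (x p q y : V) (u : Sym b) :
    pair (ev c x) (pair (ev 1 p) (pair (ev 1 q) (ev a y))) (gluedVertex a b c u) =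
      detForm p q * pair (ev c x) (ev a y) (vertex c a b u) := by
  have h : pair (ev 1 p) (pair (ev 1 q) (ev a y)) ∘ₗ
      ((TensorProduct.assoc ℂ (Sym 1) (Sym 1) (Sym a)).toLinearMap
        ∘ₗ TensorProduct.mk ℂ (Sym 1 ⊗[ℂ] Sym 1) (Sym a) (cup 1)) = detForm p q • ev a y := by
    refine LinearMap.ext fun w => ?_
    simp only [LinearMap.comp_apply, LinearEquiv.coe_coe, TensorProduct.mk_apply]
    rw [pair_assoc, pair_tmul, pair_cup, pow_one]
    rfl
  rw [gluedVertex, LinearMap.comp_apply, pair_map, h, LinearMap.comp_id, pair_smul_right]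

theorem pair_splitVertex (a b c a' c' : ℕ) (x p q y : V) (u : Sym b) :
    pair (ev c x) (pair (ev 1 p) (pair (ev 1 q) (ev a y))) (splitVertex a b c a' c' u) =
      pair (pair (ev c x) (ev 1 p) ∘ₗ vertex c 1 c') (pair (ev 1 q) (ev a y) ∘ₗ vertex 1 a a')
        (vertex c' a' b u) := by
  rw [splitVertex]
  simp only [LinearMap.comp_apply, LinearEquiv.coe_coe]
  rw [pair_assoc, pair_map]

/-- The combination of networks with stem `b` obtained from the `6j`-expansion by bending, as a
linear function of the functional applied to the leg `a'`. -/
def bentSum (a b c a' : ℕ) (x p v : V) : (Sym a' →ₗ[ℂ] ℂ) →ₗ[ℂ] ℂ :=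
  ∑ c' ∈ iadm 1 c ∩ iadm b a', sixJ 1 c a' b a c' •
    pairRight (pair (ev c x) (ev 1 p) ∘ₗ vertex c 1 c') (vertex c' a' b (pw b v))

theorem bentSum_apply (a b c a' : ℕ) (x p v : V) (f : Sym a' →ₗ[ℂ] ℂ) :
    bentSum a b c a' x p v f = ∑ c' ∈ iadm 1 c ∩ iadm b a', sixJ 1 c a' b a c' *
      pair (pair (ev c x) (ev 1 p) ∘ₗ vertex c 1 c') f (vertex c' a' b (pw b v)) := by
  rw [bentSum, LinearMap.sum_apply]; rfl

theorem bentSum_ev {a b c a' : ℕ} (h : ∃ S, IsSixJ 1 c a' b a S) (x p v y : V) :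
    bentSum a b c a' x p v (ev a' y) = (-1) ^ ((a' + b + c + 1) / 2) *
      pair (ev 1 p) (pair (ev c x) (ev b v) ∘ₗ vertex c b a) (vertex 1 a a' (pw a' y)) := by
  rw [bentSum_apply, ← pair_rightTree, (isSixJ_sixJ h).2, LinearMap.sum_apply, map_sum,
    Finset.mul_sum]
  refine Finset.sum_congr rfl fun c' hc' => ?_
  obtain ⟨h1, h2⟩ := Finset.mem_inter.1 hc'
  rw [mem_iadm] at h1 h2
  -- The signs from exchanging c with 1 and from rotating b into a' have a product independent of
  -- c', so it leaves the sum.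
  have hs : (-1 : ℂ) ^ ((a' + b + c + 1) / 2) = sgn c' 1 c * (-1) ^ ((a' + b + c') / 2) := by
    rw [sgn, ← pow_add]
    congr 1
    unfold edges
    omega
  rw [LinearMap.smul_apply, map_smul, smul_eq_mul, pair_leftTree,
    pair_vertex_swap (mem_iadm.2 (by omega)), pair_smul_left,
    pair_vertex_rotate (mem_iadm.2 (by omega)), hs]
  ring

theorem sum_fusionCoeff (a b c a' : ℕ) (x p q y v : V) :
    ∑ c' ∈ iadm 1 c ∩ iadm b a', fusionCoeff b a a' c c' *
      pair (ev c x) (pair (ev 1 p) (pair (ev 1 q) (ev a y))) (splitVertex a b c a' c' (pw b v)) =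
    sgn a' 1 a * fusionConst a' 1 a *
      bentSum a b c a' x p v (pair (ev 1 q) (ev a y) ∘ₗ vertex 1 a a') := by
  rw [bentSum_apply, Finset.mul_sum]
  refine Finset.sum_congr rfl fun c' _ => ?_
  rw [pair_splitVertex, fusionCoeff, mul_assoc]

theorem bentSum_lower {n b c : ℕ} (h : n + 1 ∈ iadm c b) (x p q y v : V) :
    bentSum (n + 1) b c n x p v (pair (ev 1 q) (ev (n + 1) y) ∘ₗ vertex 1 (n + 1) n) =
      (-1) ^ ((n + 1 + b + c) / 2) * detForm q y *
        (pair (ev c x) (ev b v) ∘ₗ vertex c b (n + 1)) (polar n p y) := by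
  rw [pair_ev_comp_vertex_one_lower, map_smul, bentSum_ev (exists_isSixJ_lower h),
    pair_ev_vertex_one_lower, smul_eq_mul, show n + b + c + 1 = n + 1 + b + c by omega]
  ring

/-- For a' = a + 1 the functional on the leg a' is not itself an evaluation but, up to the factor a
+ 1, a derivative of evaluations; so `bentSum_ev` is differentiated. -/
theorem hasDerivAt_bentSum_upper {a b c : ℕ} (h : a ∈ iadm c b) (x p q y v : V) :
    HasDerivAt (fun t : ℂ => -(-1) ^ ((a + b + c) / 2) * (detForm (y + t • q) p *
        (pair (ev c x) (ev b v) ∘ₗ vertex c b a) (pw a (y + t • q))))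
      ((a + 1) * bentSum a b c (a + 1) x p v (pair (ev 1 q) (ev a y) ∘ₗ vertex 1 a (a + 1))) 0 := by
  have hs : -(-1 : ℂ) ^ ((a + b + c) / 2) = (-1) ^ ((a + 1 + b + c + 1) / 2) := by
    rw [show (a + 1 + b + c + 1) / 2 = (a + b + c) / 2 + 1 by omega, pow_succ, mul_neg_one]
  have := hasDerivAt_apply_ev q y (bentSum a b c (a + 1) x p v)
  simpa only [bentSum_ev (exists_isSixJ_upper h), pair_ev_vertex_one_upper, hs] using this

theorem polar_plucker (n : ℕ) (p q y : V) :
    detForm p q • pw (n + 1) y + detForm y p • polar n q y + detForm q y • polar n p y = 0 := by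
  refine eq_zero_of_ev_eq_zero fun x => ?_
  simp only [map_add, map_smul, ev_pw, ev_polar, smul_eq_mul, detForm_eq]
  ring

theorem pw_zero (v w : V) : pw 0 v = pw 0 w :=
  eq_of_ev_eq fun x => by simp

/-- An arc between the upper legs of a vertex, as a combination of split vertices. -/
theorem gluedVertex_eq_sum (a b c : ℕ) (h : b ∈ iadm c a) :
    gluedVertex a b c =
      ∑ a' ∈ iadm 1 a, ∑ c' ∈ iadm 1 c ∩ iadm b a',
        fusionCoeff b a a' c c' • splitVertex a b c a' c' := by
  refine quad_ext fun v x p q y => ?_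
  have ha : a ∈ iadm c b := mem_iadm.2 (by rw [mem_iadm] at h; omega)
  simp only [LinearMap.sum_apply, LinearMap.smul_apply, map_sum, map_smul, smul_eq_mul,
    sum_fusionCoeff]
  rw [pair_gluedVertex, pair_vertex_rotate h, ← LinearMap.comp_apply]
  have hU := hasDerivAt_bentSum_upper ha x p q y v
  have hf := fusionConst_upper a
  have hsgn : sgn (a + 1) 1 a = 1 := by simp [sgn, edges, show 1 + a - (a + 1) = 0 by omega]
  rcases a with _ | n
  · rw [iadm_one_zero, Finset.sum_singleton]
    simp only [zero_add] at *
    generalize pair (ev c x) (ev b v) ∘ₗ vertex c b 0 = F at hU ⊢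
    -- In degree 0 the pure power is constant, so only [y,p] is differentiated.
    have := hU.unique ((((hasDerivAt_detForm_left y q p).mul_const (F (pw 0 y))).const_mul (-(-1) ^ ((b + c) / 2))).congr_of_eventuallyEq
        (.of_forall fun t => by simp only [pw_zero (y + t • q) y]))
    rw [hf, hsgn]
    rw [detForm_swap q p] at this
    push_cast at this
    linear_combination -this
  · rw [iadm_one_succ, Finset.sum_pair (by omega), bentSum_lower ha, fusionConst_lower]
    generalize pair (ev c x) (ev b v) ∘ₗ vertex c b (n + 1) = F at hU ⊢
    have hd := hU.unique (((hasDerivAt_detForm_left y q p).mul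
      (hasDerivAt_apply_pw q y F)).const_mul _)
    have hP := congrArg F (polar_plucker n p q y)
    have hn : (n + 2 : ℂ) ≠ 0 := by exact_mod_cast (n + 1).succ_ne_zero
    have hsgn' : sgn n 1 (n + 1) = -1 := by
      simp [sgn, edges, show (1 + (n + 1) - n) / 2 = 1 by omega]
    rw [show n + 2 = n + 1 + 1 from rfl, hf, hsgn, hsgn']
    simp only [map_add, map_smul, map_zero, smul_eq_mul, zero_smul, add_zero] at hP hd
    rw [detForm_swap q p] at hd
    push_cast at hd
    refine mul_left_cancel₀ hn ?_
    field_simp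
    -- The term a' = a + 1 supplies one copy of [p,q] F(y^a), and the Plücker relation turns the
    -- polarized terms into the other n + 1 of the required n + 2.
    linear_combination -hd + (n + 1) * (-1 : ℂ) ^ ((n + 1 + b + c) / 2) * hP

end
end SpinNetwork

theorem propositionl (a b c : ℕ) (h : b ∈ SpinNetwork.iadm c a) :
    SpinNetwork.gluedVertex a b c =
      ∑ a' ∈ SpinNetwork.iadm 1 a, ∑ c' ∈ SpinNetwork.iadm 1 c ∩ SpinNetwork.iadm b a',
        SpinNetwork.fusionCoeff b a a' c c' • SpinNetwork.splitVertex a b c a' c' := by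
  exact SpinNetwork.gluedVertex_eq_sum a b c h
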